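/- **Conventions.** An Artin algebra is a ring $\Lambda$ that is an algebra over a commutative artinian ring $R$ and finitely generated as an $R$-module. Modules over an Artin algebra are finitely generated left modules. An acyclic complex $P^\bullet\colon\cdots\to P^{i-1}\to P^i\to P^{i+1}\to\cdots$ ($i\in\mathbb Z$) of finitely generated projective $\Lambda$-modules is *totally acyclic* if $\operatorname{Hom}_\Lambda(P^\bullet,\Lambda)$ is acyclic. A $\Lambda$-module $G$ is *Gorenstein-projective*, $G\in\mathsf{Gproj}\,\Lambda$, if $G\cong\operatorname{Coker}(P^{-1}\to P^0)$ for a totally acyclic complex $P^\bullet$ of finitely generated projective $\Lambda$-modules. $(\mathsf{Gproj}\,\Lambda)^{\perp}$ is the class of finitely generated $\Lambda$-modules $K$ with $\operatorname{Ext}^1_\Lambda(G,K)=0$ for all $G\in\mathsf{Gproj}\,\Lambda$, and $\operatorname{add}K$ is the class of direct summands of finite direct sums of copies of $K$. Let $A,B$ be rings, ${}_AN_B$ an $A$-$B$-bimodule and ${}_BM_A$ a $B$-$A$-bimodule. The Morita ring with zero bimodule homomorphisms is $$\Lambda_{(0,0)}=\begin{pmatrix}A&N\\M&B\end{pmatrix},\qquad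 \begin{pmatrix}a&n\\m&b\end{pmatrix}\begin{pmatrix}a'&n'\\m'&b'\end{pmatrix}=\begin{pmatrix}aa'&an'+nb'\\ma'+bm'&bb'\end{pmatrix}.$$ A tuple $(X,Y,f,g)$ consists of an $A$-module $X$, a $B$-module $Y$, a $B$-map $f\colon M\otimes_AX\to Y$ and an $A$-map $g\colon N\otimes_BY\to X$ such that the composites $N\otimes_BM\otimes_AX\to N\otimes_BY\to X$ and $M\otimes_AN\otimes_BY\to M\otimes_AX\to Y$ are zero. It is regarded as the $\Lambda_{(0,0)}$-module $X\oplus Y$ with $\begin{pmatrix}a&n\\m&b\end{pmatrix}(x,y)=(ax+g(n\otimes y),\,by+f(m\otimes x))$. **Theorem.** Assume that $\Lambda_{(0,0)}$ is an Artin algebra and that the following conditions hold: 1. $M\otimes_A-$ sends acyclic complexes of finitely generated projective $A$-modules to acyclic complexes of $B$-modules; 2. $\operatorname{add}{}_AN\subseteq(\mathsf{Gproj}\,A)^{\perp}$; 3. $N\otimes_B-$ sends acyclic complexes of finitely generated projective $B$-modules to acyclic complexes of $A$-modules; 4. $\operatorname{add}{}_BM\subseteq(\mathsf{Gproj}\,B)^{\perp}$.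 $(\alpha)$ Let $Z\in\mathsf{Gproj}\,B$, let $s\colon N\otimes_BZ\to X$ be a monomorphism of $A$-modules with $\operatorname{Coker}s\in\mathsf{Gproj}\,A$, and let $t\colon M\otimes_A\operatorname{Coker}s\to Y$ be a monomorphism of $B$-modules together with an identification $\operatorname{Coker}t\cong Z$. Let $\pi_X\colon X\to\operatorname{Coker}s$ and $\pi_Y\colon Y\to\operatorname{Coker}t\cong Z$ be the projections. Then $(X,Y,f,g)$ is a tuple as above and is a Gorenstein-projective $\Lambda_{(0,0)}$-module, where $$f\colon M\otimes_AX\xrightarrow{\operatorname{Id}_M\otimes\pi_X}M\otimes_A\operatorname{Coker}s\xrightarrow{\ t\ }Y,\qquad g\colon N\otimes_BY\xrightarrow{\operatorname{Id}_N\otimes\pi_Y}N\otimes_BZ\xrightarrow{\ s\ }X.$$ $(\beta)$ Let $Z\in\mathsf{Gproj}\,A$, let $t\colon M\otimes_AZ\to Y$ be a monomorphism of $B$-modules with $\operatorname{Coker}t\in\mathsf{Gproj}\,B$, and let $s\colon N\otimes_B\operatorname{Coker}t\to X$ be a monomorphism of $A$-modules together with an identification $\operatorname{Coker}s\cong Z$.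 Let $\pi_X\colon X\to\operatorname{Coker}s\cong Z$ and $\pi_Y\colon Y\to\operatorname{Coker}t$ be the projections. Then $(X,Y,f,g)$ is a tuple as above and is a Gorenstein-projective $\Lambda_{(0,0)}$-module, where $$f\colon M\otimes_AX\xrightarrow{\operatorname{Id}_M\otimes\pi_X}M\otimes_AZ\xrightarrow{\ t\ }Y,\qquad g\colon N\otimes_BY\xrightarrow{\operatorname{Id}_N\otimes\pi_Y}N\otimes_B\operatorname{Coker}t\xrightarrow{\ s\ }X.$$ -/

import Mathlib

open CategoryTheory
open scoped TensorProduct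

universe u

set_option linter.unusedSectionVars false

/-! ### Tensor products over a noncommutative ring -/

section BalancedTensor

variable (A B N Y : Type u) [Ring A] [Ring B]
  [AddCommGroup N] [Module A N] [Module Bᵐᵒᵖ N] [SMulCommClass A Bᵐᵒᵖ N]
  [AddCommGroup Y] [Module B Y]

/-- The relations `n b ⊗ y = n ⊗ b y` in `N ⊗_ℤ Y`, for an `A`-`B`-bimodule `N` and a left
`B`-module `Y` (`MulOpposite.op b • n` is the right action `n b`). The generating set is stable
under `A`, so its `A`-span is the subgroup which it generates. -/
def balancedRel : Submodule A (N ⊗[ℤ] Y) :=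
  Submodule.span A
    {w | ∃ (n : N) (b : B) (y : Y), w = (MulOpposite.op b • n) ⊗ₜ[ℤ] y - n ⊗ₜ[ℤ] (b • y)}

/-- The left `A`-module `N ⊗_B Y`, for an `A`-`B`-bimodule `N` and a left `B`-module `Y`. -/
def BTensor : Type u := (N ⊗[ℤ] Y) ⧸ balancedRel A B N Y

instance : AddCommGroup (BTensor A B N Y) :=
  inferInstanceAs (AddCommGroup ((N ⊗[ℤ] Y) ⧸ balancedRel A B N Y))

instance : Module A (BTensor A B N Y) :=
  inferInstanceAs (Module A ((N ⊗[ℤ] Y) ⧸ balancedRel A B N Y))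

/-- The quotient map `N ⊗_ℤ Y → N ⊗_B Y`. -/
def btensorMk : N ⊗[ℤ] Y →ₗ[A] BTensor A B N Y := (balancedRel A B N Y).mkQ

variable {N Y}

/-- The element `n ⊗ y` of `N ⊗_B Y`. -/
def btmul (n : N) (y : Y) : BTensor A B N Y := btensorMk A B N Y (n ⊗ₜ[ℤ] y)

theorem btmul_add_left (n n' : N) (y : Y) :
    btmul A B (n + n') y = btmul A B n y + btmul A B n' y := by
  simp only [btmul, TensorProduct.add_tmul, map_add]

theorem btmul_add_right (n : N) (y y' : Y) :
    btmul A B n (y + y') = btmul A B n y + btmul A B n y' := by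
  simp only [btmul, TensorProduct.tmul_add, map_add]

theorem btmul_zero_left (y : Y) : btmul A B (0 : N) y = 0 := by
  simp only [btmul, TensorProduct.zero_tmul, map_zero]

theorem btmul_zero_right (n : N) : btmul A B n (0 : Y) = 0 := by
  simp only [btmul, TensorProduct.tmul_zero, map_zero]

theorem smul_btmul (a : A) (n : N) (y : Y) : a • btmul A B n y = btmul A B (a • n) y := by
  simp only [btmul, ← map_smul, TensorProduct.smul_tmul']

theorem btmul_balanced (n : N) (b : B) (y : Y) :
    btmul A B (MulOpposite.op b • n) y = btmul A B n (b • y) := by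
  refine (Submodule.Quotient.eq _).2 (Submodule.subset_span ?_)
  exact ⟨n, b, y, rfl⟩

theorem btensor_induction {p : BTensor A B N Y → Prop} (zero : p 0)
    (tmul : ∀ n y, p (btmul A B n y)) (add : ∀ v w, p v → p w → p (v + w))
    (w : BTensor A B N Y) : p w := by
  obtain ⟨w, rfl⟩ := Submodule.mkQ_surjective _ w
  change p (btensorMk A B N Y w)
  induction w using TensorProduct.induction_on with
  | zero => rwa [map_zero]
  | tmul n y => exact tmul n y
  | add v w hv hw => rw [map_add]; exact add _ _ hv hw

variable (N) {Y' : Type u} [AddCommGroup Y'] [Module B Y']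

/-- The map `Id_N ⊗ h : N ⊗_B Y → N ⊗_B Y'` induced by a `B`-linear map `h : Y → Y'`. -/
def bmap (h : Y →ₗ[B] Y') : BTensor A B N Y →ₗ[A] BTensor A B N Y' :=
  Submodule.mapQ (balancedRel A B N Y) (balancedRel A B N Y')
    (TensorProduct.AlgebraTensorModule.map (LinearMap.id : N →ₗ[A] N)
      h.toAddMonoidHom.toIntLinearMap)
    (by
      refine Submodule.span_le.2 ?_
      rintro _ ⟨n, b, y, rfl⟩
      refine Submodule.subset_span ⟨n, b, h y, ?_⟩
      simp [map_sub])

theorem bmap_btmul (h : Y →ₗ[B] Y') (n : N) (y : Y) :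
    bmap A B N h (btmul A B n y) = btmul A B n (h y) := rfl

end BalancedTensor

/-! ### Gorenstein-projective modules

Modules are finitely generated left modules. -/

section GorensteinProjective

/-- An acyclic complex `⋯ → P i → P (i + 1) → ⋯`, indexed by `ℤ`, of finitely generated projective
left `Λ`-modules. -/
structure AcyclicProjComplex (Λ : Type u) [Ring Λ] where
  obj : ℤ → ModuleCat.{u} Λ
  finite : ∀ i, Module.Finite Λ (obj i)
  projective : ∀ i, Module.Projective Λ (obj i)
  d : ∀ i, obj i →ₗ[Λ] obj (i + 1)
  exact : ∀ i, Function.Exact (d i) (d (i + 1))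

variable {Λ : Type u} [Ring Λ]

/-- The complex `P` is totally acyclic: the complex `Hom_Λ(P, Λ)` is acyclic as well. -/
def AcyclicProjComplex.IsTotallyAcyclic (P : AcyclicProjComplex Λ) : Prop :=
  ∀ i, Function.Exact
    (fun φ : P.obj (i + 1 + 1) →ₗ[Λ] Λ => φ ∘ₗ P.d (i + 1))
    (fun φ : P.obj (i + 1) →ₗ[Λ] Λ => φ ∘ₗ P.d i)

variable (Λ)

/-- `G` lies in `Gproj Λ`: it is the cokernel of `P (-1) → P 0` for some totally acyclic complex `P`
of finitely generated projective modules (so `G` is finitely generated). -/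
def IsGproj (G : Type u) [AddCommGroup G] [Module Λ G] : Prop :=
  ∃ P : AcyclicProjComplex Λ, P.IsTotallyAcyclic ∧
    Nonempty (G ≃ₗ[Λ] (P.obj (-1 + 1) ⧸ LinearMap.range (P.d (-1))))

/-- `K` lies in `(Gproj Λ)^⊥`: it is finitely generated and `Ext¹_Λ(G, K) = 0` for every `G` in
`Gproj Λ`. -/
def IsGprojPerp (K : Type u) [AddCommGroup K] [Module Λ K] : Prop :=
  Module.Finite Λ K ∧
    ∀ G : ModuleCat.{u} Λ, IsGproj Λ G → Subsingleton (Abelian.Ext G (ModuleCat.of Λ K) 1)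

/-- `K` lies in `add N`: it is a direct summand of a finite direct sum of copies of `N`. -/
def InAdd (N K : Type u) [AddCommGroup N] [Module Λ N] [AddCommGroup K] [Module Λ K] : Prop :=
  ∃ (n : ℕ) (i : K →ₗ[Λ] (Fin n → N)) (p : (Fin n → N) →ₗ[Λ] K), p ∘ₗ i = LinearMap.id

end GorensteinProjective

/-! ### The Morita ring with zero bimodule homomorphisms and its modules -/

section Morita

/-- Matrices `(a n; m b)` with `a ∈ A`, `n ∈ N`, `m ∈ M`, `b ∈ B`. -/
@[ext] structure MoritaRing (A B N M : Type u) where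
  a : A
  n : N
  m : M
  b : B

namespace MoritaRing

variable {A B N M : Type u} [Ring A] [Ring B]
  [AddCommGroup N] [Module A N] [Module Bᵐᵒᵖ N] [SMulCommClass A Bᵐᵒᵖ N]
  [AddCommGroup M] [Module B M] [Module Aᵐᵒᵖ M] [SMulCommClass B Aᵐᵒᵖ M]

instance : Zero (MoritaRing A B N M) := ⟨⟨0, 0, 0, 0⟩⟩
instance : One (MoritaRing A B N M) := ⟨⟨1, 0, 0, 1⟩⟩
instance : Add (MoritaRing A B N M) := ⟨fun r s => ⟨r.a + s.a, r.n + s.n, r.m + s.m, r.b + s.b⟩⟩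
instance : Neg (MoritaRing A B N M) := ⟨fun r => ⟨-r.a, -r.n, -r.m, -r.b⟩⟩

/-- `(a n; m b) (a' n'; m' b') = (a a', a n' + n b'; m a' + b m', b b')`. -/
instance : Mul (MoritaRing A B N M) :=
  ⟨fun r s => ⟨r.a * s.a, r.a • s.n + MulOpposite.op s.b • r.n,
    MulOpposite.op s.a • r.m + r.b • s.m, r.b * s.b⟩⟩

@[simp] theorem zero_a : (0 : MoritaRing A B N M).a = 0 := rfl
@[simp] theorem zero_n : (0 : MoritaRing A B N M).n = 0 := rfl
@[simp] theorem zero_m : (0 : MoritaRing A B N M).m = 0 := rfl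
@[simp] theorem zero_b : (0 : MoritaRing A B N M).b = 0 := rfl
@[simp] theorem one_a : (1 : MoritaRing A B N M).a = 1 := rfl
@[simp] theorem one_n : (1 : MoritaRing A B N M).n = 0 := rfl
@[simp] theorem one_m : (1 : MoritaRing A B N M).m = 0 := rfl
@[simp] theorem one_b : (1 : MoritaRing A B N M).b = 1 := rfl
@[simp] theorem add_a (r s : MoritaRing A B N M) : (r + s).a = r.a + s.a := rfl
@[simp] theorem add_n (r s : MoritaRing A B N M) : (r + s).n = r.n + s.n := rfl
@[simp] theorem add_m (r s : MoritaRing A B N M) : (r + s).m = r.m + s.m := rfl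
@[simp] theorem add_b (r s : MoritaRing A B N M) : (r + s).b = r.b + s.b := rfl
@[simp] theorem neg_a (r : MoritaRing A B N M) : (-r).a = -r.a := rfl
@[simp] theorem neg_n (r : MoritaRing A B N M) : (-r).n = -r.n := rfl
@[simp] theorem neg_m (r : MoritaRing A B N M) : (-r).m = -r.m := rfl
@[simp] theorem neg_b (r : MoritaRing A B N M) : (-r).b = -r.b := rfl
@[simp] theorem mul_a (r s : MoritaRing A B N M) : (r * s).a = r.a * s.a := rfl
@[simp] theorem mul_n (r s : MoritaRing A B N M) :
    (r * s).n = r.a • s.n + MulOpposite.op s.b • r.n := rfl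
@[simp] theorem mul_m (r s : MoritaRing A B N M) :
    (r * s).m = MulOpposite.op s.a • r.m + r.b • s.m := rfl
@[simp] theorem mul_b (r s : MoritaRing A B N M) : (r * s).b = r.b * s.b := rfl

instance : Ring (MoritaRing A B N M) where
  add_assoc r s t := by ext <;> simp [add_assoc]
  zero_add r := by ext <;> simp
  add_zero r := by ext <;> simp
  add_comm r s := by ext <;> simp [add_comm]
  neg_add_cancel r := by ext <;> simp
  nsmul := nsmulRec
  zsmul := zsmulRec
  left_distrib r s t := by ext <;> simp [mul_add, add_smul] <;> abel
  right_distrib r s t := by ext <;> simp [add_mul, add_smul] <;> abel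
  zero_mul r := by ext <;> simp
  mul_zero r := by ext <;> simp
  mul_assoc r s t := by
    ext
    · simp [mul_assoc]
    · simp [mul_smul, smul_add, smul_comm, add_assoc]
    · simp [mul_smul, smul_add, smul_comm, add_assoc]
    · simp [mul_assoc]
  one_mul r := by ext <;> simp
  mul_one r := by ext <;> simp

end MoritaRing

variable (A B N M : Type u) [Ring A] [Ring B]
  [AddCommGroup N] [Module A N] [Module Bᵐᵒᵖ N] [SMulCommClass A Bᵐᵒᵖ N]
  [AddCommGroup M] [Module B M] [Module Aᵐᵒᵖ M] [SMulCommClass B Aᵐᵒᵖ M]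

/-- The tuples `(X, Y, f, g)` with `f : M ⊗_A X → Y` and `g : N ⊗_B Y → X` such that both composites
`N ⊗_B M ⊗_A X → N ⊗_B Y → X` and `M ⊗_A N ⊗_B Y → M ⊗_A X → Y` vanish. -/
structure MoritaTuple (X Y : Type u) [AddCommGroup X] [Module A X] [AddCommGroup Y]
    [Module B Y] where
  f : BTensor B A M X →ₗ[B] Y
  g : BTensor A B N Y →ₗ[A] X
  g_comp_f : g ∘ₗ bmap A B N f = 0
  f_comp_g : f ∘ₗ bmap B A M g = 0

variable {A B N M} {X Y Z W : Type u} [AddCommGroup X] [Module A X] [AddCommGroup Y] [Module B Y]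
  [AddCommGroup Z] [Module B Z] [AddCommGroup W] [Module A W]

namespace MoritaTuple

/-- The abelian group `X ⊕ Y` underlying the module given by the tuple `(X, Y, f, g)`. -/
def Carrier (_T : MoritaTuple A B N M X Y) : Type u := X × Y

instance (T : MoritaTuple A B N M X Y) : AddCommGroup T.Carrier :=
  inferInstanceAs (AddCommGroup (X × Y))

/-- `(a n; m b) (x, y) = (a x + g (n ⊗ y), b y + f (m ⊗ x))`. -/
instance (T : MoritaTuple A B N M X Y) : SMul (MoritaRing A B N M) T.Carrier :=
  ⟨fun r v => ((r.a • v.1 + T.g (btmul A B r.n v.2), r.b • v.2 + T.f (btmul B A r.m v.1)) : X × Y)⟩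

theorem smul_fst (T : MoritaTuple A B N M X Y) (r : MoritaRing A B N M) (v : T.Carrier) :
    (r • v).1 = r.a • v.1 + T.g (btmul A B r.n v.2) := rfl

theorem smul_snd (T : MoritaTuple A B N M X Y) (r : MoritaRing A B N M) (v : T.Carrier) :
    (r • v).2 = r.b • v.2 + T.f (btmul B A r.m v.1) := rfl

theorem g_btmul_f (T : MoritaTuple A B N M X Y) (n : N) (w : BTensor B A M X) :
    T.g (btmul A B n (T.f w)) = 0 :=
  LinearMap.congr_fun T.g_comp_f (btmul A B n w)

theorem f_btmul_g (T : MoritaTuple A B N M X Y) (m : M) (w : BTensor A B N Y) :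
    T.f (btmul B A m (T.g w)) = 0 :=
  LinearMap.congr_fun T.f_comp_g (btmul B A m w)

theorem fst_add (T : MoritaTuple A B N M X Y) (v w : T.Carrier) : (v + w).1 = v.1 + w.1 := rfl

theorem snd_add (T : MoritaTuple A B N M X Y) (v w : T.Carrier) : (v + w).2 = v.2 + w.2 := rfl

theorem fst_zero (T : MoritaTuple A B N M X Y) : (0 : T.Carrier).1 = 0 := rfl

theorem snd_zero (T : MoritaTuple A B N M X Y) : (0 : T.Carrier).2 = 0 := rfl

/-- The module over the Morita ring given by a tuple. -/
instance (T : MoritaTuple A B N M X Y) : Module (MoritaRing A B N M) T.Carrier where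
  one_smul v := by
    refine Prod.ext ?_ ?_
    · simp [smul_fst, btmul_zero_left]
    · simp [smul_snd, btmul_zero_left]
  mul_smul r s v := by
    refine Prod.ext ?_ ?_
    · simp only [smul_fst, smul_snd, MoritaRing.mul_a, MoritaRing.mul_n, btmul_add_left,
        btmul_add_right, map_add, g_btmul_f, smul_add, ← map_smul, smul_btmul, btmul_balanced,
        mul_smul, add_zero]
      abel
    · simp only [smul_fst, smul_snd, MoritaRing.mul_b, MoritaRing.mul_m, btmul_add_left,
        btmul_add_right, map_add, f_btmul_g, smul_add, ← map_smul, smul_btmul, btmul_balanced,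
        mul_smul, add_zero]
      abel
  smul_zero r := by
    refine Prod.ext ?_ ?_
    · simp [smul_fst, fst_zero, snd_zero, btmul_zero_right]
    · simp [smul_snd, fst_zero, snd_zero, btmul_zero_right]
  smul_add r v w := by
    refine Prod.ext ?_ ?_
    · simp only [smul_fst, fst_add, snd_add, btmul_add_right, map_add, smul_add]
      abel
    · simp only [smul_snd, fst_add, snd_add, btmul_add_right, map_add, smul_add]
      abel
  add_smul r s v := by
    refine Prod.ext ?_ ?_
    · simp only [smul_fst, fst_add, MoritaRing.add_a, MoritaRing.add_n, btmul_add_left, map_add,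
        add_smul]
      abel
    · simp only [smul_snd, snd_add, MoritaRing.add_b, MoritaRing.add_m, btmul_add_left, map_add,
        add_smul]
      abel
  zero_smul v := by
    refine Prod.ext ?_ ?_
    · simp [smul_fst, fst_zero, btmul_zero_left]
    · simp [smul_snd, snd_zero, btmul_zero_left]

/-- For `s : N ⊗_B Z → X`, `πX : X → W`, `t : M ⊗_A W → Y` and `πY : Y → Z` with `πX s = 0` and
`πY t = 0`, the tuple `(X, Y, f, g)` where `f` is `M ⊗_A X → M ⊗_A W → Y` (first `Id_M ⊗ πX`, then
`t`) and `g` is `N ⊗_B Y → N ⊗_B Z → X` (first `Id_N ⊗ πY`, then `s`). -/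
def splice (s : BTensor A B N Z →ₗ[A] X) (πX : X →ₗ[A] W) (t : BTensor B A M W →ₗ[B] Y)
    (πY : Y →ₗ[B] Z) (hs : πX ∘ₗ s = 0) (ht : πY ∘ₗ t = 0) : MoritaTuple A B N M X Y where
  f := t ∘ₗ bmap B A M πX
  g := s ∘ₗ bmap A B N πY
  g_comp_f := by
    refine LinearMap.ext fun w => ?_
    induction w using btensor_induction with
    | zero => rw [map_zero, map_zero]
    | add x y hx hy => rw [map_add, map_add, hx, hy]
    | tmul n v =>
      change s (btmul A B n (πY (t (bmap B A M πX v)))) = 0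
      rw [show πY (t (bmap B A M πX v)) = 0 from LinearMap.congr_fun ht _, btmul_zero_right,
        map_zero]
  f_comp_g := by
    refine LinearMap.ext fun w => ?_
    induction w using btensor_induction with
    | zero => rw [map_zero, map_zero]
    | add x y hx hy => rw [map_add, map_add, hx, hy]
    | tmul m v =>
      change t (btmul B A m (πX (s (bmap A B N πY v)))) = 0
      rw [show πX (s (bmap A B N πY v)) = 0 from LinearMap.congr_fun hs _, btmul_zero_right,
        map_zero]

end MoritaTuple

/-- The projection of a module onto a cokernel of `s` kills `s`. -/
theorem equiv_comp_mkQ_comp {S V X' W' : Type u} [Ring S] [AddCommGroup V] [Module S V]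
    [AddCommGroup X'] [Module S X'] [AddCommGroup W'] [Module S W'] (s : V →ₗ[S] X')
    (e : (X' ⧸ LinearMap.range s) ≃ₗ[S] W') :
    (e.toLinearMap ∘ₗ (LinearMap.range s).mkQ) ∘ₗ s = 0 := by
  rw [LinearMap.comp_assoc, LinearMap.range_mkQ_comp, LinearMap.comp_zero]

end Morita

/-!
Parts (α) and (β) are the cases, where one of the two cokernel identifications is the identity, of
the following symmetric assertion (`isGproj_splice`): if `0 → N ⊗ Z → X → W → 0` and
`0 → M ⊗ W → Y → Z → 0` are exact with `W` and `Z` Gorenstein-projective, then the tuple spliced from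
these data is Gorenstein-projective.

Let `P` and `Q` be totally acyclic complexes with cocycle modules `W` and `Z` in degree `0`. The
complex `N ⊗ Q` is acyclic and its terms lie in `add N`, so that `Ext¹` from Gorenstein-projective
modules into them vanishes. Hence a horseshoe lemma (`exists_horseshoe`) works in both directions: `X`
is the cocycle module of the complex `P ⊕ N ⊗ Q` for a differential twisted by a family
`σ i : P i → N ⊗ Q (i + 1)`. Likewise `Y` is the cocycle module of `Q ⊕ M ⊗ P`, twisted by a family
`τ i : Q i → M ⊗ P (i + 1)`. Such families are the same as maps between the modules induced from `P i`
and `Q i`; as the bimodule homomorphisms are zero, `σ` and `τ` do not interact, and one gets an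
acyclic complex of finitely generated projective modules over the Morita ring (`exact_indD`,
`indTuple_finite_projective`) whose cocycle module in degree `0` is `(X, Y, f, g)`.

This complex is totally acyclic (`exact_dual_indD`): its complex of linear forms is an extension of
`Hom(P, A) ⊕ Hom(Q, B)` by `Hom(P, N) ⊕ Hom(Q, M)`. The former is acyclic because `P` and `Q` are
totally acyclic, the latter because `N` and `M` are right orthogonal to the Gorenstein-projectives.

Right exactness of `N ⊗ -` is not needed: that `N ⊗ Z` is the cocycle module of `N ⊗ Q` follows from
the acyclicity of `N ⊗ Q` and the surjectivity of `N ⊗ Q 0 → N ⊗ Z`.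
-/

/-! ### Extending maps into modules right orthogonal to Gorenstein-projective modules -/

section Complexes

variable {A : Type u} [Ring A]

/-- If `Ext¹(G, K) = 0`, then maps to `K` extend along monomorphisms with cokernel `G`. -/
theorem exists_comp_eq_of_subsingleton_ext {U V G K : Type u} [AddCommGroup U] [Module A U]
    [AddCommGroup V] [Module A V] [AddCommGroup G] [Module A G] [AddCommGroup K] [Module A K]
    (hE : Subsingleton (Abelian.Ext (ModuleCat.of A G) (ModuleCat.of A K) 1))
    {f : U →ₗ[A] V} {g : V →ₗ[A] G} (hf : Function.Injective f) (hfg : Function.Exact f g)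
    (hg : Function.Surjective g) (φ : U →ₗ[A] K) : ∃ ψ : V →ₗ[A] K, ψ ∘ₗ f = φ := by
  let S : ShortComplex (ModuleCat.{u} A) :=
    ShortComplex.mk (ModuleCat.ofHom f) (ModuleCat.ofHom g)
      (by rw [← ModuleCat.ofHom_comp, hfg.linearMap_comp_eq_zero]; rfl)
  have hS : S.ShortExact := ModuleCat.shortComplex_shortExact S hfg hf hg
  obtain ⟨x, hx⟩ := Abelian.Ext.contravariant_sequence_exact₁ hS (ModuleCat.of A K)
    (Abelian.Ext.mk₀ (ModuleCat.ofHom φ)) (add_zero 1) (Subsingleton.elim _ _)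
  obtain ⟨ψ, rfl⟩ := (Abelian.Ext.mk₀_bijective _ _).2 x
  rw [Abelian.Ext.mk₀_comp_mk₀] at hx
  have h := (Abelian.Ext.mk₀_bijective _ _).1 hx
  exact ⟨ψ.hom, congrArg ModuleCat.Hom.hom h⟩

namespace AcyclicProjComplex

/-- The identification of the terms of a complex at two equal indices. -/
def objCongr (P : AcyclicProjComplex A) {i j : ℤ} (h : i = j) : P.obj i ≃ₗ[A] P.obj j := by
  subst h
  exact LinearEquiv.refl A _

theorem exact_objCongr (P : AcyclicProjComplex A) {i j k : ℤ} (h : i + 1 = j) (h' : j + 1 = k) :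
    Function.Exact ((P.objCongr h).toLinearMap ∘ₗ P.d i) ((P.objCongr h').toLinearMap ∘ₗ P.d j) := by
  subst h h'
  exact P.exact i

theorem IsTotallyAcyclic.exact_objCongr {P : AcyclicProjComplex A} (hP : P.IsTotallyAcyclic)
    {i j k : ℤ} (h : i + 1 = j) (h' : j + 1 = k) :
    Function.Exact
      (fun φ : P.obj k →ₗ[A] A => φ ∘ₗ ((P.objCongr h').toLinearMap ∘ₗ P.d j))
      (fun φ : P.obj j →ₗ[A] A => φ ∘ₗ ((P.objCongr h).toLinearMap ∘ₗ P.d i)) := by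
  subst h h'
  exact hP i

/-- The complex `P` shifted by `k` places. -/
def shift (P : AcyclicProjComplex A) (k : ℤ) : AcyclicProjComplex A where
  obj i := P.obj (i + k)
  finite i := P.finite (i + k)
  projective i := P.projective (i + k)
  d i := (P.objCongr (add_right_comm i k 1)).toLinearMap ∘ₗ P.d (i + k)
  exact _ := P.exact_objCongr _ _

theorem IsTotallyAcyclic.shift {P : AcyclicProjComplex A} (hP : P.IsTotallyAcyclic) (k : ℤ) :
    (P.shift k).IsTotallyAcyclic :=
  fun _ => hP.exact_objCongr _ _

/-- All cokernels of a totally acyclic complex are Gorenstein-projective. -/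
theorem IsTotallyAcyclic.isGproj_coker {P : AcyclicProjComplex A} (hP : P.IsTotallyAcyclic)
    (i : ℤ) : IsGproj A (P.obj (i + 1) ⧸ LinearMap.range (P.d i)) := by
  obtain ⟨k, rfl⟩ : ∃ k, i = -1 + k := ⟨i + 1, by ring⟩
  refine ⟨P.shift k, hP.shift k, ⟨Submodule.Quotient.equiv _ _
    (P.objCongr (add_right_comm (-1) k 1)) ?_⟩⟩
  exact (LinearMap.range_comp _ _).symm

/-- If `P` is totally acyclic and `K` lies in `(Gproj A)^⊥`, then `Hom_A(P, K)` is acyclic. -/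
theorem IsTotallyAcyclic.exists_comp_d_eq {P : AcyclicProjComplex A} (hP : P.IsTotallyAcyclic)
    {K : Type u} [AddCommGroup K] [Module A K] (hK : IsGprojPerp A K) (i : ℤ)
    (φ : P.obj i →ₗ[A] K) (hφ : ∀ x, P.d i x = 0 → φ x = 0) :
    ∃ ψ : P.obj (i + 1) →ₗ[A] K, ψ ∘ₗ P.d i = φ := by
  let φ' : LinearMap.range (P.d i) →ₗ[A] K :=
    (LinearMap.ker (P.d i)).liftQ φ (fun x hx => hφ x hx) ∘ₗ (P.d i).quotKerEquivRange.symm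
  obtain ⟨ψ, hψ⟩ := exists_comp_eq_of_subsingleton_ext
    (hK.2 (ModuleCat.of A _) (hP.isGproj_coker i)) (LinearMap.range (P.d i)).injective_subtype
    (LinearMap.exact_subtype_mkQ _) (Submodule.mkQ_surjective _) φ'
  refine ⟨ψ, LinearMap.ext fun x => ?_⟩
  have h := LinearMap.congr_fun hψ ⟨P.d i x, x, rfl⟩
  have hx : (P.d i).quotKerEquivRange.symm ⟨P.d i x, x, rfl⟩ = Submodule.Quotient.mk x :=
    (LinearEquiv.symm_apply_eq _).2 rfl
  exact h.trans (congrArg ((LinearMap.ker (P.d i)).liftQ φ (fun x hx => hφ x hx)) hx)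

end AcyclicProjComplex

/-! ### A horseshoe lemma for two-sided resolutions -/

/-- Two-sided dependent choice. -/
theorem exists_int_sequence {S : ℤ → Type*} {R : ∀ i, S i → S (i + 1) → Prop}
    (right : ∀ i x, ∃ y, R i x y) (left : ∀ i y, ∃ x, R i x y) (x₀ : S 0) :
    ∃ s : ∀ i, S i, s 0 = x₀ ∧ ∀ i, R i (s i) (s (i + 1)) := by
  choose r hr using right
  choose l hl using left
  let pos : ∀ n : ℕ, S n := fun n => Nat.rec x₀ (fun k x => r k x) n
  let neg : ∀ n : ℕ, S (Int.negSucc n) :=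
    fun n => Nat.rec (l (Int.negSucc 0) x₀) (fun k x => l (Int.negSucc (k + 1)) x) n
  refine ⟨fun i => match i with
    | Int.ofNat n => pos n
    | Int.negSucc n => neg n, rfl, fun i => ?_⟩
  match i with
  | Int.ofNat n => exact hr n (pos n)
  | Int.negSucc 0 => exact hl (Int.negSucc 0) x₀
  | Int.negSucc (n + 1) => exact hl (Int.negSucc (n + 1)) (neg n)

variable (P : AcyclicProjComplex A) {C : ℤ → Type u} [∀ i, AddCommGroup (C i)]
  [∀ i, Module A (C i)] {δ : ∀ i, C i →ₗ[A] C (i + 1)}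

/-- A single component `P 0 → C 1` extends to an anticommuting family `P i → C (i + 1)` as soon as
it satisfies the obvious necessary condition: to the right one extends maps along `P.d`, to the
left one lifts them along `δ`. -/
theorem exists_twist (hδ : ∀ i, Function.Exact (δ i) (δ (i + 1)))
    (hext : ∀ i j (φ : P.obj i →ₗ[A] C j), (∀ x, P.d i x = 0 → φ x = 0) →
      ∃ ψ : P.obj (i + 1) →ₗ[A] C j, ψ ∘ₗ P.d i = φ)
    (σ₀ : P.obj 0 →ₗ[A] C (0 + 1)) (hσ₀ : ∀ x, P.d 0 x = 0 → δ (0 + 1) (σ₀ x) = 0) :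
    ∃ σ : ∀ i, P.obj i →ₗ[A] C (i + 1), σ 0 = σ₀ ∧
      ∀ i x, σ (i + 1) (P.d i x) = -δ (i + 1) (σ i x) := by
  let S : ℤ → Type u := fun i =>
    {σ : P.obj i →ₗ[A] C (i + 1) // ∀ x, P.d i x = 0 → δ (i + 1) (σ x) = 0}
  let R : ∀ i, S i → S (i + 1) → Prop := fun i σ τ => ∀ x, τ.1 (P.d i x) = -δ (i + 1) (σ.1 x)
  have right : ∀ i x, ∃ y, R i x y := by
    rintro i ⟨σ, hσ⟩
    obtain ⟨τ, hτ⟩ := hext i (i + 1 + 1) (-(δ (i + 1) ∘ₗ σ)) fun x hx => by simp [hσ x hx]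
    have hτ' : ∀ x, τ (P.d i x) = -δ (i + 1) (σ x) := fun x => LinearMap.congr_fun hτ x
    refine ⟨⟨τ, fun y hy => ?_⟩, hτ'⟩
    obtain ⟨x, rfl⟩ := (P.exact i y).1 hy
    rw [hτ', map_neg, (hδ (i + 1)).apply_apply_eq_zero, neg_zero]
  have left : ∀ i y, ∃ x, R i x y := by
    rintro i ⟨τ, hτ⟩
    have := P.projective i
    let τ' : P.obj i →ₗ[A] LinearMap.range (δ (i + 1)) :=
      LinearMap.codRestrict _ (-(τ ∘ₗ P.d i)) fun x => by
        refine neg_mem ((hδ (i + 1) _).1 (hτ _ ((P.exact i).apply_apply_eq_zero x)))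
    obtain ⟨σ, hσ⟩ := Module.projective_lifting_property (δ (i + 1)).rangeRestrict τ'
      (LinearMap.surjective_rangeRestrict _)
    have hσ' : ∀ x, δ (i + 1) (σ x) = -τ (P.d i x) := fun x =>
      congrArg Subtype.val (LinearMap.congr_fun hσ x)
    exact ⟨⟨σ, fun x hx => by rw [hσ', hx, map_zero, neg_zero]⟩, fun x => by rw [hσ', neg_neg]⟩
  obtain ⟨s, hs₀, hs⟩ := exists_int_sequence right left ⟨σ₀, hσ₀⟩
  exact ⟨fun i => (s i).1, congrArg Subtype.val hs₀, hs⟩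

/-- The map `P i ⊕ C i → P (i + 1) ⊕ C (i + 1)` with components `P.d`, `δ` and `σ : P → C[1]`. -/
def twistD (δ : ∀ i, C i →ₗ[A] C (i + 1)) (σ : ∀ i, P.obj i →ₗ[A] C (i + 1)) (i : ℤ) :
    (P.obj i × C i) →ₗ[A] (P.obj (i + 1) × C (i + 1)) :=
  LinearMap.prod (P.d i ∘ₗ LinearMap.fst A _ _) (LinearMap.coprod (σ i) (δ i))

theorem twistD_apply (σ : ∀ i, P.obj i →ₗ[A] C (i + 1)) (i : ℤ) (v : P.obj i × C i) :
    twistD P δ σ i v = (P.d i v.1, σ i v.1 + δ i v.2) := rfl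

theorem exact_twistD (hδ : ∀ i, Function.Exact (δ i) (δ (i + 1)))
    {σ : ∀ i, P.obj i →ₗ[A] C (i + 1)} (hσ : ∀ i x, σ (i + 1) (P.d i x) = -δ (i + 1) (σ i x))
    (i : ℤ) : Function.Exact (twistD P δ σ i) (twistD P δ σ (i + 1)) := by
  rintro ⟨p, c⟩
  constructor
  · intro h
    obtain ⟨h₁, h₂⟩ := Prod.ext_iff.1 h
    obtain ⟨p', rfl⟩ := (P.exact i p).1 h₁
    have h₃ : δ (i + 1) (c - σ i p') = 0 := by
      have : σ (i + 1) (P.d i p') + δ (i + 1) c = 0 := h₂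
      rw [hσ] at this
      rw [map_sub, ← this]; abel
    obtain ⟨c', hc'⟩ := (hδ i _).1 h₃
    refine ⟨(p', c'), Prod.ext rfl ?_⟩
    change σ i p' + δ i c' = c
    rw [hc']; abel
  · rintro ⟨⟨p', c'⟩, h⟩
    obtain ⟨rfl, rfl⟩ := Prod.ext_iff.1 h
    refine Prod.ext ((P.exact i).apply_apply_eq_zero p') ?_
    change σ (i + 1) (P.d i p') + δ (i + 1) (σ i p' + δ i c') = 0
    rw [hσ, map_add, (hδ i).apply_apply_eq_zero]; abel

/-- Horseshoe lemma. Let `0 → K → X → W → 0` be exact, let `P` be an acyclic complex of projectives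
with cocycle module `W` in degree `0` and `C` an acyclic complex with cocycle module `K` in
degree `0`. If maps to the terms of `C` extend along `P.d` and `K → C 1` extends to `X`, then some
twisted sum of `P` and `C` has cocycle module `X` in degree `0`. -/
theorem exists_horseshoe (hδ : ∀ i, Function.Exact (δ i) (δ (i + 1)))
    (hext : ∀ i j (φ : P.obj i →ₗ[A] C j), (∀ x, P.d i x = 0 → φ x = 0) →
      ∃ ψ : P.obj (i + 1) →ₗ[A] C j, ψ ∘ₗ P.d i = φ)
    {K X W : Type u} [AddCommGroup K] [Module A K] [AddCommGroup X] [Module A X]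
    [AddCommGroup W] [Module A W] {s : K →ₗ[A] X} {π : X →ₗ[A] W}
    (hsπ : Function.Exact s π) (hπ : Function.Surjective π)
    {ε : P.obj (-1 + 1) →ₗ[A] W} (hdε : Function.Exact (P.d (-1)) ε)
    (hε : Function.Surjective ε)
    {η : C (-1 + 1) →ₗ[A] K} (hη : Function.Surjective η) {ι : K →ₗ[A] C (-1 + 1 + 1)}
    (hι : Function.Injective ι) (hιη : ∀ c, ι (η c) = δ (-1 + 1) c)
    (α : X →ₗ[A] C (-1 + 1 + 1)) (hα : ∀ k, α (s k) = ι k) :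
    ∃ (σ : ∀ i, P.obj i →ₗ[A] C (i + 1)) (ρ : P.obj (-1 + 1) →ₗ[A] X),
      (∀ i x, σ (i + 1) (P.d i x) = -δ (i + 1) (σ i x)) ∧ (∀ p, π (ρ p) = ε p) ∧
      Function.Exact (twistD P δ σ (-1)) (LinearMap.coprod ρ (s ∘ₗ η)) ∧
      Function.Surjective (LinearMap.coprod ρ (s ∘ₗ η)) := by
  have := P.projective (-1 + 1)
  obtain ⟨ρ, hρ⟩ := Module.projective_lifting_property π ε hπ
  have hρ' : ∀ p, π (ρ p) = ε p := fun p => LinearMap.congr_fun hρ p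
  have hδι : ∀ k, δ (-1 + 1 + 1) (ι k) = 0 := fun k => by
    obtain ⟨c, rfl⟩ := hη k
    rw [hιη, (hδ (-1 + 1)).apply_apply_eq_zero]
  -- The maps `π` and `α` are jointly injective.
  have hinj : ∀ x, π x = 0 → α x = 0 → x = 0 := fun x h₁ h₂ => by
    obtain ⟨k, rfl⟩ := (hsπ x).1 h₁
    rw [hα] at h₂
    rw [(map_eq_zero_iff ι hι).1 h₂, map_zero]
  have h₀ : ∀ x, P.d (-1 + 1) x = 0 → δ (-1 + 1 + 1) ((α ∘ₗ ρ) x) = 0 := fun x hx => by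
    obtain ⟨y, rfl⟩ := (P.exact (-1) x).1 hx
    obtain ⟨k, hk⟩ := (hsπ (ρ (P.d (-1) y))).1 (by rw [hρ', hdε.apply_apply_eq_zero])
    rw [LinearMap.comp_apply, ← hk, hα, hδι]
  obtain ⟨σ, hσ₀, hσ⟩ := exists_twist P hδ hext (α ∘ₗ ρ) h₀
  have hσ₁ : ∀ p, σ (-1 + 1) p = α (ρ p) := fun p => LinearMap.congr_fun hσ₀ p
  refine ⟨σ, ρ, hσ, hρ', ?_, ?_⟩
  · rintro ⟨p, c⟩
    constructor
    · intro h
      have h : ρ p + s (η c) = 0 := h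
      have h₁ : ε p = 0 := by
        rw [← hρ', ← map_zero π, ← h, map_add, hsπ.apply_apply_eq_zero, add_zero]
      obtain ⟨p', rfl⟩ := (hdε p).1 h₁
      have h₂ : δ (-1 + 1) (c - σ (-1) p') = 0 := by
        have := congrArg α h
        rw [map_add, hα, hιη, ← hσ₁, hσ, map_zero] at this
        rw [map_sub, ← this]; abel
      obtain ⟨c', hc'⟩ := (hδ (-1) _).1 h₂
      refine ⟨(p', c'), Prod.ext rfl ?_⟩
      change σ (-1) p' + δ (-1) c' = c
      rw [hc']; abel
    · rintro ⟨⟨p', c'⟩, h⟩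
      obtain ⟨rfl, rfl⟩ := Prod.ext_iff.1 h
      change ρ (P.d (-1) p') + s (η (σ (-1) p' + δ (-1) c')) = 0
      refine hinj _ ?_ ?_
      · rw [map_add, hρ', hdε.apply_apply_eq_zero, hsπ.apply_apply_eq_zero, add_zero]
      · rw [map_add, hα, hιη, ← hσ₁, hσ, map_add, (hδ (-1)).apply_apply_eq_zero]; abel
  · intro x
    obtain ⟨p, hp⟩ := hε (π x)
    obtain ⟨k, hk⟩ := (hsπ (x - ρ p)).1 (by rw [map_sub, hρ', hp, sub_self])
    obtain ⟨c, rfl⟩ := hη k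
    refine ⟨(p, c), ?_⟩
    change ρ p + s (η c) = x
    rw [hk]; abel

end Complexes

/-! ### Tensoring with a bimodule -/

section Tensor

variable {A B N Y Y' Y'' : Type u} [Ring A] [Ring B]
  [AddCommGroup N] [Module A N] [Module Bᵐᵒᵖ N] [SMulCommClass A Bᵐᵒᵖ N]
  [AddCommGroup Y] [Module B Y] [AddCommGroup Y'] [Module B Y'] [AddCommGroup Y''] [Module B Y'']

theorem btensor_hom_ext {C : Type*} [AddCommGroup C] [Module A C]
    {φ ψ : BTensor A B N Y →ₗ[A] C} (h : ∀ n y, φ (btmul A B n y) = ψ (btmul A B n y)) : φ = ψ := by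
  refine LinearMap.ext fun w => ?_
  induction w using btensor_induction with
  | zero => rw [map_zero, map_zero]
  | tmul n y => exact h n y
  | add v w hv hw => rw [map_add, map_add, hv, hw]

theorem bmap_bmap (g : Y' →ₗ[B] Y'') (h : Y →ₗ[B] Y') (w : BTensor A B N Y) :
    bmap A B N g (bmap A B N h w) = bmap A B N (g ∘ₗ h) w :=
  LinearMap.congr_fun (f := bmap A B N g ∘ₗ bmap A B N h) (g := bmap A B N (g ∘ₗ h))
    (btensor_hom_ext fun _ _ => rfl) w

theorem bmap_surjective {h : Y →ₗ[B] Y'} (hh : Function.Surjective h) :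
    Function.Surjective (bmap A B N h) := by
  intro w
  induction w using btensor_induction with
  | zero => exact ⟨0, map_zero _⟩
  | tmul n y =>
    obtain ⟨y, rfl⟩ := hh y
    exact ⟨btmul A B n y, bmap_btmul A B N h n y⟩
  | add v w hv hw =>
    obtain ⟨v, rfl⟩ := hv
    obtain ⟨w, rfl⟩ := hw
    exact ⟨v + w, map_add _ _ _⟩

/-- The map `n ↦ n ⊗ y`. -/
def btmulLeft (y : Y) : N →ₗ[A] BTensor A B N Y where
  toFun n := btmul A B n y
  map_add' n n' := btmul_add_left A B n n' y
  map_smul' a n := (smul_btmul A B a n y).symm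

/-- The contraction `N ⊗_B Y → N ⊗_B B = N`, `n ⊗ y ↦ n β(y)`, with a linear form `β` on `Y`. -/
def bcontract (β : Y →ₗ[B] B) : BTensor A B N Y →ₗ[A] N :=
  (balancedRel A B N Y).liftQ
    (TensorProduct.AlgebraTensorModule.lift
      (LinearMap.mk₂' A ℤ (fun (n : N) (y : Y) => MulOpposite.op (β y) • n)
        (fun n n' y => smul_add _ n n') (fun a n y => (smul_comm a _ n).symm)
        (fun n y y' => by rw [map_add, MulOpposite.op_add, add_smul])
        (fun c n y => by rw [map_zsmul, MulOpposite.op_smul, smul_assoc])))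
    (by
      refine Submodule.span_le.2 ?_
      rintro _ ⟨n, b, y, rfl⟩
      simp [mul_smul])

theorem bcontract_btmul (β : Y →ₗ[B] B) (n : N) (y : Y) :
    bcontract β (btmul A B n y) = MulOpposite.op (β y) • n := rfl

theorem bcontract_bmap (β : Y' →ₗ[B] B) (h : Y →ₗ[B] Y') (w : BTensor A B N Y) :
    bcontract β (bmap A B N h w) = bcontract (β ∘ₗ h) w :=
  LinearMap.congr_fun (f := bcontract β ∘ₗ bmap A B N h) (g := bcontract (β ∘ₗ h))
    (btensor_hom_ext fun n y => by
      rw [LinearMap.comp_apply, bmap_btmul, bcontract_btmul, bcontract_btmul,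
        LinearMap.comp_apply]) w

/-- A finitely generated projective module has a finite dual basis. -/
theorem exists_dual_basis (B Y : Type u) [Ring B] [AddCommGroup Y] [Module B Y]
    (hf : Module.Finite B Y) (hp : Module.Projective B Y) :
    ∃ (n : ℕ) (y : Fin n → Y) (β : Fin n → (Y →ₗ[B] B)), ∀ v, ∑ i, β i v • y i = v := by
  obtain ⟨n, f, g, -, -, hfg⟩ := Module.Finite.exists_comp_eq_id_of_projective B Y
  refine ⟨n, fun i => f (Pi.single i 1), fun i => LinearMap.proj i ∘ₗ g, fun v => ?_⟩
  conv_rhs => rw [← LinearMap.id_apply (R := B) v, ← hfg, LinearMap.comp_apply,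
    pi_eq_sum_univ' (g v), map_sum]
  refine Finset.sum_congr rfl fun i _ => ?_
  rw [LinearMap.comp_apply, LinearMap.proj_apply, ← map_smul]

theorem btmulLeft_apply (n : N) (y : Y) : btmulLeft y n = btmul A B n y := rfl

theorem sum_btmul_bcontract {n : ℕ} {y : Fin n → Y} {β : Fin n → (Y →ₗ[B] B)}
    (h : ∀ v, ∑ i, β i v • y i = v) (w : BTensor A B N Y) :
    ∑ i, btmul A B (bcontract (β i) w) (y i) = w := by
  have : (∑ i, btmulLeft (y i) ∘ₗ bcontract (β i) : BTensor A B N Y →ₗ[A] BTensor A B N Y) =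
      LinearMap.id := by
    refine btensor_hom_ext fun n v => ?_
    simp only [LinearMap.sum_apply, LinearMap.comp_apply, bcontract_btmul, LinearMap.id_apply]
    conv_rhs => rw [← h v]
    have hs : ∀ g : Y → BTensor A B N Y, g = (fun v => btmul A B n v) →
        g (∑ i, β i v • y i) = ∑ i, g (β i v • y i) := by
      rintro _ rfl
      exact map_sum (AddMonoidHom.mk' (fun v => btmul A B n v) (btmul_add_right A B n)) _ _
    rw [hs _ rfl]
    exact Finset.sum_congr rfl fun i _ => btmul_balanced A B n _ _
  simpa [btmulLeft_apply] using LinearMap.congr_fun this w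

theorem inAdd_bTensor (hf : Module.Finite B Y) (hp : Module.Projective B Y) :
    InAdd A N (BTensor A B N Y) := by
  obtain ⟨n, y, β, h⟩ := exists_dual_basis B Y hf hp
  refine ⟨n, LinearMap.pi fun i => bcontract (β i),
    ∑ i, btmulLeft (y i) ∘ₗ LinearMap.proj i, LinearMap.ext fun w => ?_⟩
  simpa [btmulLeft_apply] using sum_btmul_bcontract h w

theorem inAdd_self (A N : Type u) [Ring A] [AddCommGroup N] [Module A N] : InAdd A N N :=
  ⟨1, LinearMap.pi fun _ => LinearMap.id, LinearMap.proj 0, rfl⟩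

end Tensor

/-! ### Modules over the Morita ring induced from the two corners -/

section Induced

variable {A B N M : Type u} [Ring A] [Ring B]
  [AddCommGroup N] [Module A N] [Module Bᵐᵒᵖ N] [SMulCommClass A Bᵐᵒᵖ N]
  [AddCommGroup M] [Module B M] [Module Aᵐᵒᵖ M] [SMulCommClass B Aᵐᵒᵖ M]

section SpliceMap

variable {X Y Z W X' Y' Z' W' : Type u} [AddCommGroup X] [Module A X] [AddCommGroup Y] [Module B Y]
  [AddCommGroup Z] [Module B Z] [AddCommGroup W] [Module A W]
  [AddCommGroup X'] [Module A X'] [AddCommGroup Y'] [Module B Y']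
  [AddCommGroup Z'] [Module B Z'] [AddCommGroup W'] [Module A W']
  {s : BTensor A B N Z →ₗ[A] X} {πX : X →ₗ[A] W} {t : BTensor B A M W →ₗ[B] Y}
  {πY : Y →ₗ[B] Z} {hs : πX ∘ₗ s = 0} {ht : πY ∘ₗ t = 0}
  {s' : BTensor A B N Z' →ₗ[A] X'} {πX' : X' →ₗ[A] W'} {t' : BTensor B A M W' →ₗ[B] Y'}
  {πY' : Y' →ₗ[B] Z'} {hs' : πX' ∘ₗ s' = 0} {ht' : πY' ∘ₗ t' = 0}

/-- The map of modules over the Morita ring given by maps `x`, `y`, `z`, `w` which are compatible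
with the data defining two spliced tuples. -/
def spliceMap (x : X →ₗ[A] X') (y : Y →ₗ[B] Y') (z : Z →ₗ[B] Z') (w : W →ₗ[A] W')
    (hxs : ∀ v, x (s v) = s' (bmap A B N z v)) (hxπ : ∀ v, πX' (x v) = w (πX v))
    (hyt : ∀ v, y (t v) = t' (bmap B A M w v)) (hyπ : ∀ v, πY' (y v) = z (πY v)) :
    (MoritaTuple.splice s πX t πY hs ht).Carrier →ₗ[MoritaRing A B N M]
      (MoritaTuple.splice s' πX' t' πY' hs' ht').Carrier where
  toFun v := ((x v.1, y v.2) : X' × Y')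
  map_add' v v' := Prod.ext (map_add x v.1 v'.1) (map_add y v.2 v'.2)
  map_smul' r v := by
    refine Prod.ext ?_ ?_
    · change x (r.a • v.1 + s (btmul A B r.n (πY v.2))) =
        r.a • x v.1 + s' (btmul A B r.n (πY' (y v.2)))
      rw [map_add, map_smul, hxs, hyπ, bmap_btmul]
    · change y (r.b • v.2 + t (btmul B A r.m (πX v.1))) =
        r.b • y v.2 + t' (btmul B A r.m (πX' (x v.1)))
      rw [map_add, map_smul, hyt, hxπ, bmap_btmul]

end SpliceMap

variable (A B N M) (P Q : Type u) [AddCommGroup P] [Module A P] [AddCommGroup Q] [Module B Q]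

/-- The tuple of the module induced from the `A`-module `P` and the `B`-module `Q`, that is
`Λ e_A ⊗_A P ⊕ Λ e_B ⊗_B Q` with `X = P ⊕ N ⊗_B Q` and `Y = Q ⊕ M ⊗_A P`. -/
abbrev indTuple : MoritaTuple A B N M (P × BTensor A B N Q) (Q × BTensor B A M P) :=
  MoritaTuple.splice (LinearMap.inr A _ _) (LinearMap.fst A _ _) (LinearMap.inr B _ _)
    (LinearMap.fst B _ _) (LinearMap.fst_comp_inr A _ _) (LinearMap.fst_comp_inr B _ _)

variable {A B N M P Q}

theorem indTuple_smul (r : MoritaRing A B N M) (v : (indTuple A B N M P Q).Carrier) :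
    r • v = (((r.a • v.1.1, r.a • v.1.2 + btmul A B r.n v.2.1),
      (r.b • v.2.1, r.b • v.2.2 + btmul B A r.m v.1.1)) :
        (P × BTensor A B N Q) × (Q × BTensor B A M P)) := by
  refine Prod.ext (Prod.ext ?_ rfl) (Prod.ext ?_ rfl)
  · exact add_zero (r.a • v.1.1)
  · exact add_zero (r.b • v.2.1)

/-- A linear form on an induced module is determined by its restriction to `P`, with values in
`e_A Λ = A ⊕ N`, and its restriction to `Q`, with values in `e_B Λ = M ⊕ B`. -/
def indForm (α : P →ₗ[A] A) (ν : P →ₗ[A] N) (μ : Q →ₗ[B] M) (β : Q →ₗ[B] B) :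
    (indTuple A B N M P Q).Carrier →ₗ[MoritaRing A B N M] MoritaRing A B N M where
  toFun v := ⟨α v.1.1, ν v.1.1 + bcontract β v.1.2, μ v.2.1 + bcontract α v.2.2, β v.2.1⟩
  map_add' v w := by
    change MoritaRing.mk (α (v.1.1 + w.1.1)) (ν (v.1.1 + w.1.1) + bcontract β (v.1.2 + w.1.2))
      (μ (v.2.1 + w.2.1) + bcontract α (v.2.2 + w.2.2)) (β (v.2.1 + w.2.1)) = _
    refine MoritaRing.ext ?_ ?_ ?_ ?_
    · simp
    · simp only [map_add, MoritaRing.add_n]; abel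
    · simp only [map_add, MoritaRing.add_m]; abel
    · simp
  map_smul' r v := by
    rw [indTuple_smul]
    refine MoritaRing.ext ?_ ?_ ?_ ?_
    · simp
    · simp only [map_add, map_smul, bcontract_btmul, RingHom.id_apply, smul_eq_mul,
        MoritaRing.mul_n, smul_add, add_assoc]
    · simp only [map_add, map_smul, bcontract_btmul, RingHom.id_apply, smul_eq_mul,
        MoritaRing.mul_m, smul_add]
      abel
    · simp

theorem indForm_apply (α : P →ₗ[A] A) (ν : P →ₗ[A] N) (μ : Q →ₗ[B] M) (β : Q →ₗ[B] B)
    (v : (indTuple A B N M P Q).Carrier) : indForm α ν μ β v =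
      ⟨α v.1.1, ν v.1.1 + bcontract β v.1.2, μ v.2.1 + bcontract α v.2.2, β v.2.1⟩ := rfl

/-- The element `p` of the summand `P` of an induced module. -/
def indA (p : P) : (indTuple A B N M P Q).Carrier :=
  (((p, 0), (0, 0)) : (P × BTensor A B N Q) × (Q × BTensor B A M P))

/-- The element `q` of the summand `Q` of an induced module. -/
def indB (q : Q) : (indTuple A B N M P Q).Carrier :=
  (((0, 0), (q, 0)) : (P × BTensor A B N Q) × (Q × BTensor B A M P))

theorem indA_add (p p' : P) :
    (indA (p + p') : (indTuple A B N M P Q).Carrier) = indA p + indA p' :=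
  Prod.ext (Prod.ext rfl (add_zero 0).symm) (Prod.ext (add_zero 0).symm (add_zero 0).symm)

theorem indB_add (q q' : Q) :
    (indB (q + q') : (indTuple A B N M P Q).Carrier) = indB q + indB q' :=
  Prod.ext (Prod.ext (add_zero 0).symm (add_zero 0).symm) (Prod.ext rfl (add_zero 0).symm)

theorem smul_indA (r : MoritaRing A B N M) (p : P) :
    r • (indA p : (indTuple A B N M P Q).Carrier) =
      (((r.a • p, 0), (0, btmul B A r.m p)) : (P × BTensor A B N Q) × (Q × BTensor B A M P)) := by
  rw [indTuple_smul]
  refine Prod.ext (Prod.ext ?_ ?_) (Prod.ext ?_ ?_) <;> simp [indA, btmul_zero_right]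

theorem smul_indB (r : MoritaRing A B N M) (q : Q) :
    r • (indB q : (indTuple A B N M P Q).Carrier) =
      (((0, btmul A B r.n q), (r.b • q, 0)) : (P × BTensor A B N Q) × (Q × BTensor B A M P)) := by
  rw [indTuple_smul]
  refine Prod.ext (Prod.ext ?_ ?_) (Prod.ext ?_ ?_) <;> simp [indB, btmul_zero_right]

theorem indForm_indA (α : P →ₗ[A] A) (ν : P →ₗ[A] N) (μ : Q →ₗ[B] M) (β : Q →ₗ[B] B) (p : P) :
    indForm α ν μ β (indA p) = ⟨α p, ν p, 0, 0⟩ := by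
  rw [indForm_apply]
  refine MoritaRing.ext ?_ ?_ ?_ ?_ <;> simp [indA]

theorem indForm_indB (α : P →ₗ[A] A) (ν : P →ₗ[A] N) (μ : Q →ₗ[B] M) (β : Q →ₗ[B] B) (q : Q) :
    indForm α ν μ β (indB q) = ⟨0, 0, μ q, β q⟩ := by
  rw [indForm_apply]
  refine MoritaRing.ext ?_ ?_ ?_ ?_ <;> simp [indB]

/-- The summands `P` and `Q` generate the induced module. -/
theorem ind_hom_ext {V : Type*} [AddCommGroup V] [Module (MoritaRing A B N M) V]
    {φ ψ : (indTuple A B N M P Q).Carrier →ₗ[MoritaRing A B N M] V}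
    (hA : ∀ p, φ (indA p) = ψ (indA p)) (hB : ∀ q, φ (indB q) = ψ (indB q)) : φ = ψ := by
  let iN : BTensor A B N Q →+ (indTuple A B N M P Q).Carrier :=
    AddMonoidHom.mk' (fun w => (((0, w), (0, 0)) : (P × BTensor A B N Q) × (Q × BTensor B A M P)))
      fun v w => Prod.ext (Prod.ext (add_zero 0).symm rfl)
        (Prod.ext (add_zero 0).symm (add_zero 0).symm)
  let iM : BTensor B A M P →+ (indTuple A B N M P Q).Carrier :=
    AddMonoidHom.mk' (fun w => (((0, 0), (0, w)) : (P × BTensor A B N Q) × (Q × BTensor B A M P)))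
      fun v w => Prod.ext (Prod.ext (add_zero 0).symm (add_zero 0).symm)
        (Prod.ext (add_zero 0).symm rfl)
  have hN : ∀ w, φ (iN w) = ψ (iN w) := fun w => by
    induction w using btensor_induction with
    | zero => simp only [map_zero]
    | add v w hv hw => simp only [map_add, hv, hw]
    | tmul n q =>
      have : iN (btmul A B n q) = (⟨0, n, 0, 0⟩ : MoritaRing A B N M) • indB q := by
        rw [smul_indB, zero_smul]; rfl
      rw [this, map_smul, map_smul, hB]
  have hM : ∀ w, φ (iM w) = ψ (iM w) := fun w => by
    induction w using btensor_induction with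
    | zero => simp only [map_zero]
    | add v w hv hw => simp only [map_add, hv, hw]
    | tmul m p =>
      have : iM (btmul B A m p) = (⟨0, 0, m, 0⟩ : MoritaRing A B N M) • indA p := by
        rw [smul_indA, zero_smul]; rfl
      rw [this, map_smul, map_smul, hA]
  refine LinearMap.ext fun v => ?_
  have hv : v = indA v.1.1 + iN v.1.2 + (indB v.2.1 + iM v.2.2) := by
    refine Prod.ext (Prod.ext ?_ ?_) (Prod.ext ?_ ?_)
    · change v.1.1 = v.1.1 + 0 + (0 + 0); abel
    · change v.1.2 = 0 + v.1.2 + (0 + 0); abel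
    · change v.2.1 = 0 + 0 + (v.2.1 + 0); abel
    · change v.2.2 = 0 + 0 + (0 + v.2.2); abel
  rw [hv]
  simp only [map_add, hA, hB, hN, hM]

theorem exists_eq_indForm
    (φ : (indTuple A B N M P Q).Carrier →ₗ[MoritaRing A B N M] MoritaRing A B N M) :
    ∃ α ν μ β, φ = indForm α ν μ β := by
  have hsA : ∀ (a : A) (p : P), (indA (a • p) : (indTuple A B N M P Q).Carrier) =
      (⟨a, 0, 0, 0⟩ : MoritaRing A B N M) • indA p := fun a p => by
    rw [smul_indA, btmul_zero_left]; rfl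
  have hsB : ∀ (b : B) (q : Q), (indB (b • q) : (indTuple A B N M P Q).Carrier) =
      (⟨0, 0, 0, b⟩ : MoritaRing A B N M) • indB q := fun b q => by
    rw [smul_indB, btmul_zero_left]; rfl
  -- `p` and `q` are fixed by the idempotents `e_A` and `e_B`, hence so are their images.
  have hA : ∀ p, φ (indA p) = (⟨1, 0, 0, 0⟩ : MoritaRing A B N M) * φ (indA p) := fun p => by
    rw [← smul_eq_mul, ← map_smul, ← hsA, one_smul]
  have hB : ∀ q, φ (indB q) = (⟨0, 0, 0, 1⟩ : MoritaRing A B N M) * φ (indB q) := fun q => by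
    rw [← smul_eq_mul, ← map_smul, ← hsB, one_smul]
  refine ⟨
    { toFun := fun p => (φ (indA p)).a
      map_add' := fun p p' => by rw [indA_add, map_add, MoritaRing.add_a]
      map_smul' := fun a p => by rw [hsA, map_smul]; rfl },
    { toFun := fun p => (φ (indA p)).n
      map_add' := fun p p' => by rw [indA_add, map_add, MoritaRing.add_n]
      map_smul' := fun a p => by rw [hsA, map_smul]; simp },
    { toFun := fun q => (φ (indB q)).m
      map_add' := fun q q' => by rw [indB_add, map_add, MoritaRing.add_m]
      map_smul' := fun b q => by rw [hsB, map_smul]; simp },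
    { toFun := fun q => (φ (indB q)).b
      map_add' := fun q q' => by rw [indB_add, map_add, MoritaRing.add_b]
      map_smul' := fun b q => by rw [hsB, map_smul]; rfl },
    ind_hom_ext (fun p => ?_) (fun q => ?_)⟩
  · rw [indForm_indA]
    refine MoritaRing.ext rfl rfl ?_ ?_ <;> rw [hA] <;> simp
  · rw [indForm_indB]
    refine MoritaRing.ext ?_ ?_ rfl rfl <;> rw [hB] <;> simp

/-- The dual bases of `P` and `Q` give a dual basis of the induced module. -/
theorem indTuple_finite_projective (hPf : Module.Finite A P) (hPp : Module.Projective A P)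
    (hQf : Module.Finite B Q) (hQp : Module.Projective B Q) :
    Module.Finite (MoritaRing A B N M) (indTuple A B N M P Q).Carrier ∧
      Module.Projective (MoritaRing A B N M) (indTuple A B N M P Q).Carrier := by
  obtain ⟨k, p, α, hα⟩ := exists_dual_basis A P hPf hPp
  obtain ⟨l, q, β, hβ⟩ := exists_dual_basis B Q hQf hQp
  let Λ := MoritaRing A B N M
  let i : (indTuple A B N M P Q).Carrier →ₗ[Λ] ((Fin k → Λ) × (Fin l → Λ)) :=
    LinearMap.prod (LinearMap.pi fun i => indForm (α i) 0 0 0)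
      (LinearMap.pi fun j => indForm 0 0 0 (β j))
  let r : ((Fin k → Λ) × (Fin l → Λ)) →ₗ[Λ] (indTuple A B N M P Q).Carrier :=
    LinearMap.coprod (∑ i, LinearMap.toSpanSingleton Λ _ (indA (p i)) ∘ₗ LinearMap.proj i)
      (∑ j, LinearMap.toSpanSingleton Λ _ (indB (q j)) ∘ₗ LinearMap.proj j)
  have hr : r ∘ₗ i = LinearMap.id := by
    refine ind_hom_ext (fun x => ?_) (fun y => ?_)
    · let ia : P →+ (indTuple A B N M P Q).Carrier := AddMonoidHom.mk' indA indA_add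
      have h₁ : ∀ i, indForm (A := A) (B := B) (N := N) (M := M) (Q := Q) (α i) 0 0 0 (indA x) •
          indA (p i) =
          ia (α i x • p i) := fun i => by
        rw [indForm_indA, smul_indA, btmul_zero_left]
        rfl
      have h₂ : ∀ j, indForm (A := A) (B := B) (N := N) (M := M) (P := P) 0 0 0 (β j) (indA x) •
          indB (q j) =
          (0 : (indTuple A B N M P Q).Carrier) := fun j => by
        rw [indForm_indA, smul_indB]
        simp only [LinearMap.zero_apply, zero_smul, btmul_zero_left]
        rfl
      have : r (i (indA x)) = ∑ i, ia (α i x • p i) + ∑ j : Fin l, 0 := by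
        rw [← Finset.sum_congr rfl fun i _ => h₁ i, ← Finset.sum_congr rfl fun j _ => h₂ j]
        simp [r, i]
      rw [LinearMap.comp_apply, this, ← map_sum, hα, Finset.sum_const_zero, add_zero]
      rfl
    · let ib : Q →+ (indTuple A B N M P Q).Carrier := AddMonoidHom.mk' indB indB_add
      have h₁ : ∀ j, indForm (A := A) (B := B) (N := N) (M := M) (P := P) 0 0 0 (β j) (indB y) •
          indB (q j) =
          ib (β j y • q j) := fun j => by
        rw [indForm_indB, smul_indB, btmul_zero_left]
        rfl
      have h₂ : ∀ i, indForm (A := A) (B := B) (N := N) (M := M) (Q := Q) (α i) 0 0 0 (indB y) •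
          indA (p i) =
          (0 : (indTuple A B N M P Q).Carrier) := fun i => by
        rw [indForm_indB, smul_indA]
        simp only [LinearMap.zero_apply, zero_smul, btmul_zero_left]
        rfl
      have : r (i (indB y)) = ∑ i : Fin k, 0 + ∑ j, ib (β j y • q j) := by
        rw [← Finset.sum_congr rfl fun j _ => h₁ j, ← Finset.sum_congr rfl fun i _ => h₂ i]
        simp [r, i]
      rw [LinearMap.comp_apply, this, ← map_sum, hβ, Finset.sum_const_zero, zero_add]
      rfl
  exact ⟨Module.Finite.of_surjective r fun v => ⟨i v, LinearMap.congr_fun hr v⟩,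
    Module.Projective.of_split i r hr⟩

end Induced

/-! ### The twisted induced complex -/

section Complex

variable {A B N M : Type u} [Ring A] [Ring B]
  [AddCommGroup N] [Module A N] [Module Bᵐᵒᵖ N] [SMulCommClass A Bᵐᵒᵖ N]
  [AddCommGroup M] [Module B M] [Module Aᵐᵒᵖ M] [SMulCommClass B Aᵐᵒᵖ M]
  (P : AcyclicProjComplex A) (Q : AcyclicProjComplex B)

/-- The differential on the modules induced from `P i` and `Q i`, twisted by families
`σ : P i → N ⊗ Q (i + 1)` and `τ : Q i → M ⊗ P (i + 1)`. -/
def indD (σ : ∀ i, P.obj i →ₗ[A] BTensor A B N (Q.obj (i + 1)))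
    (τ : ∀ i, Q.obj i →ₗ[B] BTensor B A M (P.obj (i + 1))) (i : ℤ) :
    (indTuple A B N M (P.obj i) (Q.obj i)).Carrier →ₗ[MoritaRing A B N M]
      (indTuple A B N M (P.obj (i + 1)) (Q.obj (i + 1))).Carrier :=
  spliceMap (twistD P (fun i => bmap A B N (Q.d i)) σ i)
    (twistD Q (fun i => bmap B A M (P.d i)) τ i) (Q.d i) (P.d i)
    (fun v => by simp [twistD_apply]) (fun _ => rfl) (fun v => by simp [twistD_apply])
    (fun _ => rfl)

variable {P Q} {σ : ∀ i, P.obj i →ₗ[A] BTensor A B N (Q.obj (i + 1))}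
  {τ : ∀ i, Q.obj i →ₗ[B] BTensor B A M (P.obj (i + 1))}

theorem indForm_comp_indD (i : ℤ) (α : P.obj (i + 1) →ₗ[A] A) (ν : P.obj (i + 1) →ₗ[A] N)
    (μ : Q.obj (i + 1) →ₗ[B] M) (β : Q.obj (i + 1) →ₗ[B] B) :
    indForm α ν μ β ∘ₗ indD P Q σ τ i =
      indForm (α ∘ₗ P.d i) (ν ∘ₗ P.d i + bcontract β ∘ₗ σ i)
        (μ ∘ₗ Q.d i + bcontract α ∘ₗ τ i) (β ∘ₗ Q.d i) := by
  refine ind_hom_ext (fun p => ?_) (fun q => ?_)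
  · have h : indD P Q σ τ i (indA p) = (((P.d i p, σ i p), (0, 0)) :
        (P.obj (i + 1) × BTensor A B N (Q.obj (i + 1))) ×
          (Q.obj (i + 1) × BTensor B A M (P.obj (i + 1)))) := by
      refine Prod.ext (Prod.ext rfl ?_) (Prod.ext ?_ ?_)
      · change σ i p + bmap A B N (Q.d i) 0 = σ i p
        rw [map_zero, add_zero]
      · exact map_zero (Q.d i)
      · change τ i 0 + bmap B A M (P.d i) 0 = 0
        rw [map_zero, map_zero, add_zero]
    rw [indForm_indA]
    refine (congrArg (indForm α ν μ β) h).trans ?_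
    change MoritaRing.mk (α (P.d i p)) (ν (P.d i p) + bcontract β (σ i p))
      (μ 0 + bcontract α 0) (β 0) = _
    refine MoritaRing.ext ?_ ?_ ?_ ?_ <;> simp
  · have h : indD P Q σ τ i (indB q) = (((0, 0), (Q.d i q, τ i q)) :
        (P.obj (i + 1) × BTensor A B N (Q.obj (i + 1))) ×
          (Q.obj (i + 1) × BTensor B A M (P.obj (i + 1)))) := by
      refine Prod.ext (Prod.ext ?_ ?_) (Prod.ext rfl ?_)
      · exact map_zero (P.d i)
      · change σ i 0 + bmap A B N (Q.d i) 0 = 0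
        rw [map_zero, map_zero, add_zero]
      · change τ i q + bmap B A M (P.d i) 0 = τ i q
        rw [map_zero, add_zero]
    rw [indForm_indB]
    refine (congrArg (indForm α ν μ β) h).trans ?_
    change MoritaRing.mk (α 0) (ν 0 + bcontract β 0)
      (μ (Q.d i q) + bcontract α (τ i q)) (β (Q.d i q)) = _
    refine MoritaRing.ext ?_ ?_ ?_ ?_ <;> simp

theorem exact_indD
    (hQ : ∀ i, Function.Exact (bmap A B N (Q.d i)) (bmap A B N (Q.d (i + 1))))
    (hP : ∀ i, Function.Exact (bmap B A M (P.d i)) (bmap B A M (P.d (i + 1))))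
    (hσ : ∀ i x, σ (i + 1) (P.d i x) = -bmap A B N (Q.d (i + 1)) (σ i x))
    (hτ : ∀ i x, τ (i + 1) (Q.d i x) = -bmap B A M (P.d (i + 1)) (τ i x)) (i : ℤ) :
    Function.Exact (indD P Q σ τ i) (indD P Q σ τ (i + 1)) := by
  have h₁ := exact_twistD P (δ := fun i => bmap A B N (Q.d i)) hQ hσ i
  have h₂ := exact_twistD Q (δ := fun i => bmap B A M (P.d i)) hP hτ i
  intro v
  constructor
  · intro h
    obtain ⟨hv₁, hv₂⟩ := Prod.ext_iff.1 h
    obtain ⟨u₁, hu₁⟩ := (h₁ v.1).1 hv₁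
    obtain ⟨u₂, hu₂⟩ := (h₂ v.2).1 hv₂
    exact ⟨(u₁, u₂), Prod.ext hu₁ hu₂⟩
  · rintro ⟨u, rfl⟩
    exact Prod.ext (h₁.apply_apply_eq_zero u.1) (h₂.apply_apply_eq_zero u.2)

/-- The `N`-component of a linear form which is a cocycle, once its `B`-component has been written as
the coboundary of `β`, is the `N`-component of a coboundary: the correction by `β` makes it a cocycle
of the acyclic complex `Hom_A(P, N)`. -/
theorem exists_comp_d_add_twist_eq (hP : P.IsTotallyAcyclic) (hN : IsGprojPerp A N)
    (hσ : ∀ i x, σ (i + 1) (P.d i x) = -bmap A B N (Q.d (i + 1)) (σ i x)) (i : ℤ)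
    (ν : P.obj (i + 1) →ₗ[A] N) (β : Q.obj (i + 1 + 1) →ₗ[B] B)
    (h : ν ∘ₗ P.d i + bcontract (β ∘ₗ Q.d (i + 1)) ∘ₗ σ i = 0) :
    ∃ ν' : P.obj (i + 1 + 1) →ₗ[A] N,
      ν' ∘ₗ P.d (i + 1) + bcontract β ∘ₗ σ (i + 1) = ν := by
  obtain ⟨ν', hν'⟩ := hP.exists_comp_d_eq hN (i + 1) (ν - bcontract β ∘ₗ σ (i + 1)) fun x hx => by
    obtain ⟨y, rfl⟩ := (P.exact i x).1 hx
    have hy : ν (P.d i y) + bcontract (β ∘ₗ Q.d (i + 1)) (σ i y) = 0 := LinearMap.congr_fun h y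
    rw [LinearMap.sub_apply, LinearMap.comp_apply, hσ, map_neg, bcontract_bmap, sub_neg_eq_add, hy]
  exact ⟨ν', by rw [hν', sub_add_cancel]⟩

theorem indForm_injective {P Q : Type u} [AddCommGroup P] [Module A P] [AddCommGroup Q] [Module B Q]
    {α α' : P →ₗ[A] A} {ν ν' : P →ₗ[A] N} {μ μ' : Q →ₗ[B] M} {β β' : Q →ₗ[B] B}
    (h : indForm α ν μ β = indForm α' ν' μ' β') : α = α' ∧ ν = ν' ∧ μ = μ' ∧ β = β' := by
  have hA : ∀ p, (⟨α p, ν p, 0, 0⟩ : MoritaRing A B N M) = ⟨α' p, ν' p, 0, 0⟩ := fun p => by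
    rw [← indForm_indA α ν μ β, h, indForm_indA]
  have hB : ∀ q, (⟨0, 0, μ q, β q⟩ : MoritaRing A B N M) = ⟨0, 0, μ' q, β' q⟩ := fun q => by
    rw [← indForm_indB α ν μ β, h, indForm_indB]
  exact ⟨LinearMap.ext fun p => congrArg MoritaRing.a (hA p),
    LinearMap.ext fun p => congrArg MoritaRing.n (hA p),
    LinearMap.ext fun q => congrArg MoritaRing.m (hB q),
    LinearMap.ext fun q => congrArg MoritaRing.b (hB q)⟩

/-- In the complex of linear forms on the twisted induced complex, the forms with values in `N` and
`M` are a subcomplex with quotient `Hom(P, A) ⊕ Hom(Q, B)`, and all of these are acyclic. -/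
theorem exact_dual_indD (hP : P.IsTotallyAcyclic) (hQ : Q.IsTotallyAcyclic)
    (hN : IsGprojPerp A N) (hM : IsGprojPerp B M)
    (hσ : ∀ i x, σ (i + 1) (P.d i x) = -bmap A B N (Q.d (i + 1)) (σ i x))
    (hτ : ∀ i x, τ (i + 1) (Q.d i x) = -bmap B A M (P.d (i + 1)) (τ i x))
    (hd : ∀ i, Function.Exact (indD P Q σ τ i) (indD P Q σ τ (i + 1))) (i : ℤ) :
    Function.Exact
      (fun φ : (indTuple A B N M (P.obj (i + 1 + 1)) (Q.obj (i + 1 + 1))).Carrier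
        →ₗ[MoritaRing A B N M] MoritaRing A B N M => φ ∘ₗ indD P Q σ τ (i + 1))
      (fun φ : (indTuple A B N M (P.obj (i + 1)) (Q.obj (i + 1))).Carrier
        →ₗ[MoritaRing A B N M] MoritaRing A B N M => φ ∘ₗ indD P Q σ τ i) := by
  intro φ
  constructor
  · intro h
    obtain ⟨α, ν, μ, β, rfl⟩ := exists_eq_indForm φ
    have h0 : indForm (A := A) (B := B) (N := N) (M := M) (0 : P.obj i →ₗ[A] A) 0 0
        (0 : Q.obj i →ₗ[B] B) = 0 :=
      ind_hom_ext (fun p => by rw [indForm_indA]; rfl) (fun q => by rw [indForm_indB]; rfl)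
    have h : indForm α ν μ β ∘ₗ indD P Q σ τ i = 0 := h
    rw [indForm_comp_indD, ← h0] at h
    obtain ⟨h₁, h₂, h₃, h₄⟩ := indForm_injective h
    obtain ⟨α', rfl⟩ := (hP i α).1 h₁
    obtain ⟨β', rfl⟩ := (hQ i β).1 h₄
    obtain ⟨ν', rfl⟩ := exists_comp_d_add_twist_eq hP hN hσ i ν β' h₂
    obtain ⟨μ', rfl⟩ := exists_comp_d_add_twist_eq hQ hM hτ i μ α' h₃
    exact ⟨indForm α' ν' μ' β', indForm_comp_indD (i + 1) α' ν' μ' β'⟩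
  · rintro ⟨ψ, rfl⟩
    refine LinearMap.ext fun v => ?_
    change ψ (indD P Q σ τ (i + 1) (indD P Q σ τ i v)) = 0
    rw [(hd i).apply_apply_eq_zero, map_zero]

end Complex

/-! ### Spliced tuples are Gorenstein-projective -/

section Main

variable {A B N M : Type u} [Ring A] [Ring B]
  [AddCommGroup N] [Module A N] [Module Bᵐᵒᵖ N] [SMulCommClass A Bᵐᵒᵖ N]
  [AddCommGroup M] [Module B M] [Module Aᵐᵒᵖ M] [SMulCommClass B Aᵐᵒᵖ M]

/-- The projection of a module onto a cokernel of `s` is exact after `s`. -/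
theorem exact_equiv_comp_mkQ {S V X' W' : Type u} [Ring S] [AddCommGroup V] [Module S V]
    [AddCommGroup X'] [Module S X'] [AddCommGroup W'] [Module S W'] (s : V →ₗ[S] X')
    (e : (X' ⧸ LinearMap.range s) ≃ₗ[S] W') :
    Function.Exact s (e.toLinearMap ∘ₗ (LinearMap.range s).mkQ) := by
  refine LinearMap.exact_iff.2 ?_
  rw [LinearEquiv.ker_comp, Submodule.ker_mkQ]

/-- A differential of a complex factors through the cokernel `W` of the preceding one. -/
theorem AcyclicProjComplex.exists_factorization (P : AcyclicProjComplex A) (i : ℤ)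
    {W : Type u} [AddCommGroup W] [Module A W]
    (e : W ≃ₗ[A] (P.obj (i + 1) ⧸ LinearMap.range (P.d i))) :
    ∃ (ε : P.obj (i + 1) →ₗ[A] W) (κ : W →ₗ[A] P.obj (i + 1 + 1)),
      Function.Surjective ε ∧ Function.Exact (P.d i) ε ∧
        ∀ p, κ (ε p) = P.d (i + 1) p := by
  have hker := (P.exact i).linearMap_ker_eq
  refine ⟨e.symm.toLinearMap ∘ₗ (LinearMap.range (P.d i)).mkQ,
    (LinearMap.range (P.d i)).liftQ (P.d (i + 1)) hker.ge ∘ₗ e.toLinearMap,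
    e.symm.surjective.comp (Submodule.mkQ_surjective _), ?_, fun p => ?_⟩
  · exact exact_equiv_comp_mkQ (P.d i) e.symm
  · simp

/-- The horseshoe lemma applied to `0 → N ⊗ Z → X → W → 0` and to the complexes `P` and `N ⊗ Q`. -/
theorem exists_tensor_horseshoe {P : AcyclicProjComplex A} {Q : AcyclicProjComplex B}
    (hP : P.IsTotallyAcyclic)
    (hN_perp : ∀ (K : Type u) [AddCommGroup K] [Module A K], InAdd A N K → IsGprojPerp A K)
    (hQ : ∀ i, Function.Exact (bmap A B N (Q.d i)) (bmap A B N (Q.d (i + 1))))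
    {X Z W : Type u} [AddCommGroup X] [Module A X] [AddCommGroup Z] [Module B Z]
    [AddCommGroup W] [Module A W] {s : BTensor A B N Z →ₗ[A] X} {π : X →ₗ[A] W}
    (hs : Function.Injective s) (hsπ : Function.Exact s π) (hπ : Function.Surjective π)
    (hW : IsGproj A W)
    {ε : P.obj (-1 + 1) →ₗ[A] W} (hdε : Function.Exact (P.d (-1)) ε)
    (hε : Function.Surjective ε)
    {η : Q.obj (-1 + 1) →ₗ[B] Z} {κ : Z →ₗ[B] Q.obj (-1 + 1 + 1)} (hη : Function.Surjective η)
    (hdη : Function.Exact (Q.d (-1)) η) (hκη : ∀ q, κ (η q) = Q.d (-1 + 1) q) :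
    ∃ (σ : ∀ i, P.obj i →ₗ[A] BTensor A B N (Q.obj (i + 1))) (ρ : P.obj (-1 + 1) →ₗ[A] X),
      (∀ i x, σ (i + 1) (P.d i x) = -bmap A B N (Q.d (i + 1)) (σ i x)) ∧
      (∀ p, π (ρ p) = ε p) ∧
      Function.Exact (twistD P (fun i => bmap A B N (Q.d i)) σ (-1))
        (LinearMap.coprod ρ (s ∘ₗ bmap A B N η)) ∧
      Function.Surjective (LinearMap.coprod ρ (s ∘ₗ bmap A B N η)) := by
  have hperp : ∀ j, IsGprojPerp A (BTensor A B N (Q.obj j)) := fun j =>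
    hN_perp _ (inAdd_bTensor (Q.finite j) (Q.projective j))
  have hικ : ∀ c, bmap A B N κ (bmap A B N η c) = bmap A B N (Q.d (-1 + 1)) c := fun c => by
    rw [bmap_bmap, show κ ∘ₗ η = Q.d (-1 + 1) from LinearMap.ext hκη]
  obtain ⟨α, hα⟩ := exists_comp_eq_of_subsingleton_ext
    ((hperp (-1 + 1 + 1)).2 (ModuleCat.of A W) hW) hs hsπ hπ (bmap A B N κ)
  refine exists_horseshoe P (δ := fun i => bmap A B N (Q.d i)) hQ
    (fun i j φ hφ => hP.exists_comp_d_eq (hperp j) i φ hφ) hsπ hπ hdε hε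
    (bmap_surjective hη) ((injective_iff_map_eq_zero (bmap A B N κ)).2 fun w hw => ?_) hικ α
    fun k => LinearMap.congr_fun hα k
  -- `N ⊗ κ` is injective because `N ⊗ Q` is exact in degree `0`.
  obtain ⟨c, rfl⟩ := bmap_surjective hη w
  rw [hικ] at hw
  obtain ⟨c', rfl⟩ := (hQ (-1) c).1 hw
  rw [bmap_bmap, hdη.linearMap_comp_eq_zero]
  exact LinearMap.congr_fun (f := bmap A B N 0) (g := 0)
    (btensor_hom_ext fun n y => by
      rw [bmap_btmul, LinearMap.zero_apply, btmul_zero_right, LinearMap.zero_apply]) c'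

/-- The symmetric form of the theorem, for short exact sequences `0 → N ⊗ Z → X → W → 0` and
`0 → M ⊗ W → Y → Z → 0` with `W` and `Z` Gorenstein-projective. -/
theorem isGproj_splice
    (hM : ∀ (P : AcyclicProjComplex A) (i : ℤ),
      Function.Exact (bmap B A M (P.d i)) (bmap B A M (P.d (i + 1))))
    (hN_perp : ∀ (K : Type u) [AddCommGroup K] [Module A K], InAdd A N K → IsGprojPerp A K)
    (hN : ∀ (Q : AcyclicProjComplex B) (i : ℤ),
      Function.Exact (bmap A B N (Q.d i)) (bmap A B N (Q.d (i + 1))))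
    (hM_perp : ∀ (K : Type u) [AddCommGroup K] [Module B K], InAdd B M K → IsGprojPerp B K)
    {X Y Z W : Type u} [AddCommGroup X] [Module A X] [AddCommGroup Y] [Module B Y]
    [AddCommGroup Z] [Module B Z] [AddCommGroup W] [Module A W]
    {s : BTensor A B N Z →ₗ[A] X} {πX : X →ₗ[A] W} {t : BTensor B A M W →ₗ[B] Y}
    {πY : Y →ₗ[B] Z} (hs : πX ∘ₗ s = 0) (ht : πY ∘ₗ t = 0) (hW : IsGproj A W) (hZ : IsGproj B Z)
    (hs_inj : Function.Injective s) (hsπ : Function.Exact s πX) (hπX : Function.Surjective πX)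
    (ht_inj : Function.Injective t) (htπ : Function.Exact t πY) (hπY : Function.Surjective πY) :
    IsGproj (MoritaRing A B N M) (MoritaTuple.splice s πX t πY hs ht).Carrier := by
  obtain ⟨P, hP, ⟨eP⟩⟩ := id hW
  obtain ⟨Q, hQ, ⟨eQ⟩⟩ := id hZ
  obtain ⟨ε, κ, hε, hdε, hκε⟩ := P.exists_factorization (-1) eP
  obtain ⟨η, θ, hη, hdη, hθη⟩ := Q.exists_factorization (-1) eQ
  obtain ⟨σ, ρ, hσ, hρ, hexX, hsurjX⟩ :=
    exists_tensor_horseshoe hP hN_perp (hN Q) hs_inj hsπ hπX hW hdε hε hη hdη hθη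
  obtain ⟨τ, ρ', hτ, hρ', hexY, hsurjY⟩ :=
    exists_tensor_horseshoe hQ hM_perp (hM P) ht_inj htπ hπY hZ hdη hη hε hdε hκε
  have hd := exact_indD (hN Q) (hM P) hσ hτ
  let T : AcyclicProjComplex (MoritaRing A B N M) :=
    { obj := fun i => ModuleCat.of _ (indTuple A B N M (P.obj i) (Q.obj i)).Carrier
      finite := fun i => (indTuple_finite_projective (P.finite i) (P.projective i) (Q.finite i)
        (Q.projective i)).1
      projective := fun i => (indTuple_finite_projective (P.finite i) (P.projective i) (Q.finite i)
        (Q.projective i)).2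
      d := indD P Q σ τ
      exact := hd }
  let a : (indTuple A B N M (P.obj (-1 + 1)) (Q.obj (-1 + 1))).Carrier →ₗ[MoritaRing A B N M]
      (MoritaTuple.splice s πX t πY hs ht).Carrier :=
    spliceMap (LinearMap.coprod ρ (s ∘ₗ bmap A B N η)) (LinearMap.coprod ρ' (t ∘ₗ bmap B A M ε)) η ε
      (fun v => by simp)
      (fun v => by simp [hρ, hsπ.apply_apply_eq_zero])
      (fun v => by simp)
      (fun v => by simp [hρ', htπ.apply_apply_eq_zero])
  have ha : Function.Surjective a := fun v => by
    obtain ⟨x, hx⟩ := hsurjX v.1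
    obtain ⟨y, hy⟩ := hsurjY v.2
    exact ⟨(x, y), Prod.ext hx hy⟩
  have hda : Function.Exact (indD P Q σ τ (-1)) a := by
    intro v
    constructor
    · intro h
      obtain ⟨hv₁, hv₂⟩ := Prod.ext_iff.1 h
      obtain ⟨u₁, hu₁⟩ := (hexX v.1).1 hv₁
      obtain ⟨u₂, hu₂⟩ := (hexY v.2).1 hv₂
      exact ⟨(u₁, u₂), Prod.ext hu₁ hu₂⟩
    · rintro ⟨u, rfl⟩
      exact Prod.ext (hexX.apply_apply_eq_zero u.1) (hexY.apply_apply_eq_zero u.2)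
  exact ⟨T, exact_dual_indD hP hQ (hN_perp N (inAdd_self A N)) (hM_perp M (inAdd_self B M)) hσ hτ hd,
    ⟨(hda.linearEquivOfSurjective ha).symm⟩⟩

end Main

theorem theorem3p8
    (A B N M : Type u) [Ring A] [Ring B]
    [AddCommGroup N] [Module A N] [Module Bᵐᵒᵖ N] [SMulCommClass A Bᵐᵒᵖ N]
    [AddCommGroup M] [Module B M] [Module Aᵐᵒᵖ M] [SMulCommClass B Aᵐᵒᵖ M]
    -- the Morita ring is an Artin algebra
    (R : Type*) [CommRing R] [IsArtinianRing R]
    [Algebra R (MoritaRing A B N M)] [Module.Finite R (MoritaRing A B N M)]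
    -- the compatibility conditions
    (hM : ∀ (P : AcyclicProjComplex A) (i : ℤ),
      Function.Exact (bmap B A M (P.d i)) (bmap B A M (P.d (i + 1))))
    (hN_perp : ∀ (K : Type u) [AddCommGroup K] [Module A K], InAdd A N K → IsGprojPerp A K)
    (hN : ∀ (Q : AcyclicProjComplex B) (i : ℤ),
      Function.Exact (bmap A B N (Q.d i)) (bmap A B N (Q.d (i + 1))))
    (hM_perp : ∀ (K : Type u) [AddCommGroup K] [Module B K], InAdd B M K → IsGprojPerp B K) :
    -- part (α)
    (∀ (X Y Z : Type u) [AddCommGroup X] [Module A X] [AddCommGroup Y] [Module B Y]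
        [AddCommGroup Z] [Module B Z]
        (s : BTensor A B N Z →ₗ[A] X)
        (t : BTensor B A M (X ⧸ LinearMap.range s) →ₗ[B] Y)
        (e : (Y ⧸ LinearMap.range t) ≃ₗ[B] Z),
        IsGproj B Z → Function.Injective s → IsGproj A (X ⧸ LinearMap.range s) →
        Function.Injective t →
        IsGproj (MoritaRing A B N M)
          (MoritaTuple.splice s (LinearMap.range s).mkQ t
            (e.toLinearMap ∘ₗ (LinearMap.range t).mkQ)
            (LinearMap.range_mkQ_comp s) (equiv_comp_mkQ_comp t e)).Carrier) ∧
    -- part (β)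
    (∀ (X Y Z : Type u) [AddCommGroup X] [Module A X] [AddCommGroup Y] [Module B Y]
        [AddCommGroup Z] [Module A Z]
        (t : BTensor B A M Z →ₗ[B] Y)
        (s : BTensor A B N (Y ⧸ LinearMap.range t) →ₗ[A] X)
        (e : (X ⧸ LinearMap.range s) ≃ₗ[A] Z),
        IsGproj A Z → Function.Injective t → IsGproj B (Y ⧸ LinearMap.range t) →
        Function.Injective s →
        IsGproj (MoritaRing A B N M)
          (MoritaTuple.splice s (e.toLinearMap ∘ₗ (LinearMap.range s).mkQ) t
            (LinearMap.range t).mkQ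
            (equiv_comp_mkQ_comp s e) (LinearMap.range_mkQ_comp t)).Carrier) := by
  refine ⟨?_, ?_⟩
  · intro X Y Z _ _ _ _ _ _ s t e hZ hs hW ht
    exact isGproj_splice hM hN_perp hN hM_perp _ _ hW hZ hs (LinearMap.exact_map_mkQ_range s)
      (Submodule.mkQ_surjective _) ht (exact_equiv_comp_mkQ t e)
      (e.surjective.comp (Submodule.mkQ_surjective _))
  · intro X Y Z _ _ _ _ _ _ t s e hZ ht hW hs
    exact isGproj_splice hM hN_perp hN hM_perp _ _ hZ hW hs (exact_equiv_comp_mkQ s e)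
      (e.surjective.comp (Submodule.mkQ_surjective _)) ht (LinearMap.exact_map_mkQ_range t)
      (Submodule.mkQ_surjective _)
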